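/- Let $\Sigma$ be a finite alphabet. For $k\ge 1$, the $k$-rewbs over $\Sigma$ and their label sets $\mathrm{var}$ are generated by: $a\in\Sigma\cup\{\varepsilon\}$ (with $\mathrm{var}=\emptyset$); references $\backslash i$ with $1\le i\le k$ (with $\mathrm{var}=\{i\}$); $\alpha_0\alpha_1$, $\alpha_0+\alpha_1$ and $\alpha_0^*$ (with $\mathrm{var}$ the union over the parts); and captures $(_j\,\alpha_0\,)_j$ with $1\le j\le k$ and $j\notin\mathrm{var}(\alpha_0)$ (with $\mathrm{var}=\mathrm{var}(\alpha_0)\cup\{j\}$). A rewb over $\Sigma$ is an ordinary regular expression over $\Sigma$ or a $k$-rewb for some $k\ge 1$. The language $L(\alpha)$ of a regular expression is the usual one. For a $k$-rewb, $L(\alpha)=\{\mathcal D_k(v): v\in\mathcal R_k(\alpha)\}$, where $\mathcal R_k(\alpha)$ is the regular language over $\Sigma\uplus\{[_i,]_i: 1\le i\le k\}\uplus\{1,\dots,k\}$ obtained by reading $\backslash i$ as the symbol $i$ and $(_j\,\alpha_0\,)_j$ as $[_j\,\alpha_0\,]_j$, and where $\mathcal D_k$ replaces, from left to right, each symbol $i$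 by the string (brackets deleted) between the nearest preceding $[_i$ and the first $]_i$ after that $[_i$ — by $\varepsilon$ if no $[_i$ precedes, being undefined if the required $]_i$ does not occur before the symbol $i$ — and finally deletes all brackets. A rewb is without a captured reference if no reference $\backslash i$ occurs inside any capture $(_j\cdots)_j$. A (one-way nondeterministic) stack automaton has finite sets $Q$ of states and $\Gamma$ of stack symbols, a start state, an initial stack symbol $Z_0\in\Gamma$, a set of final states, and a stack $\#Z_1\cdots Z_n\$$ with a pointer to one of $\#,Z_1,\dots,Z_n$. Each move depends on the state, the current input symbol, and the symbol pointed to (and whether this is the topmost symbol $Z_n$, a lower one, or $\#$). It changes the state, leaves the input cursor in place or moves it one symbol to the right, and either moves the pointer — only down from the topmost symbol; down, not at all, or up from a lower symbol $Z_j$ with $1\le j<n$; only up from $\#$ — or, if the pointer is at the topmost symbol $Z$, replaces $Z$ by a string $w\in\Gamma^*$, with the pointer moving to the new top; in each situation only finitely many moves are possible. No move is made once the input is exhausted. A word is accepted if some computation starting in the start state with stack $\#Z_0\$$ and pointer at $Z_0$ consumes the whole input and ends in a final state. The automaton is nonerasing if every replacing string $w$ begins with the replaced symbol $Z$; a nonerasing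 stack language is a language recognized by a nonerasing stack automaton. Then: 1. For every finite alphabet $\Sigma$ and every rewb $\alpha$ over $\Sigma$ without a captured reference, $L(\alpha)$ is a nonerasing stack language. 2. The converse fails: it is not the case that every nonerasing stack language over a finite alphabet is described by a rewb without a captured reference. 3. More precisely, for every finite alphabet $\Sigma$ and all distinct $a,b\in\Sigma$, the language $\{a^nb^n: n\in\mathbb N\}$ is a nonerasing stack language, but no rewb over $\Sigma$ (with or without captured references) describes it. -/

import Mathlib

universe u

open scoped Computability

/-! ### Regular expressions with backreferences -/

/-- Raw expressions with labels `[k]` (represented by `Fin k`): a letter or `ε`, a reference `\i`,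
concatenation, alternation, Kleene star, and the capture `(_j α )_j`. The side condition on
captures is `PreRewb.WellFormed`. -/
inductive PreRewb (A : Type u) (k : ℕ) : Type u
  | eps : PreRewb A k
  | letter : A → PreRewb A k
  | ref : Fin k → PreRewb A k
  | concat : PreRewb A k → PreRewb A k → PreRewb A k
  | alt : PreRewb A k → PreRewb A k → PreRewb A k
  | star : PreRewb A k → PreRewb A k
  | capture : Fin k → PreRewb A k → PreRewb A k

/-- The alphabet `Σ ⊎ B_k ⊎ [k]`: letters, brackets `[_i` and `]_i`, and label symbols `i`. -/
inductive RefSym (A : Type u) (k : ℕ) : Type u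
  | letter : A → RefSym A k
  | opening : Fin k → RefSym A k
  | closing : Fin k → RefSym A k
  | ref : Fin k → RefSym A k

namespace RefSym

variable {A : Type u} {k : ℕ}

/-- Is the symbol the left bracket `[_i`? -/
def isOpening (i : Fin k) : RefSym A k → Bool
  | opening j => decide (j = i)
  | _ => false

/-- Is the symbol the right bracket `]_i`? -/
def isClosing (i : Fin k) : RefSym A k → Bool
  | closing j => decide (j = i)
  | _ => false

/-- The letter carried by a symbol, if any. -/
def toLetter? : RefSym A k → Option A
  | letter a => some a
  | _ => none

/-- The homomorphism keeping letters and erasing brackets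
(it is only applied to strings without label symbols). -/
def eraseBrackets (v : List (RefSym A k)) : List A :=
  v.filterMap toLetter?

/-- The part of `p` strictly after its rightmost `[_i` (all of `p` if there is no `[_i`). -/
def afterLastOpening (i : Fin k) (p : List (RefSym A k)) : List (RefSym A k) :=
  (p.reverse.takeWhile fun x => !isOpening i x).reverse

/-- The string that replaces a label symbol `i` preceded by the (already dereferenced) string `p`:
it is `ε` if `p` contains no `[_i`; otherwise it is the string between the rightmost `[_i` in `p`
and the first `]_i` after it, with brackets erased, undefined if there is no such `]_i`. -/
def capturedValue (i : Fin k) (p : List (RefSym A k)) : Option (List A) :=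
  if p.any (isOpening i) then
    if (afterLastOpening i p).any (isClosing i) then
      some (eraseBrackets ((afterLastOpening i p).takeWhile fun x => !isClosing i x))
    else none
  else some []

/-- `derefFrom p v` dereferences `p v`, where `p` contains no label symbol: the label symbols of
`v` are replaced from left to right, and in the end all brackets are erased. -/
def derefFrom : List (RefSym A k) → List (RefSym A k) → Option (List A)
  | p, [] => some (eraseBrackets p)
  | p, ref i :: v =>
    match capturedValue i p with
    | some w => derefFrom (p ++ w.map letter) v
    | none => none
  | p, letter a :: v => derefFrom (p ++ [letter a]) v
  | p, opening j :: v => derefFrom (p ++ [opening j]) v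
  | p, closing j :: v => derefFrom (p ++ [closing j]) v

/-- The dereferencing partial function `D_k : (Σ ⊎ B_k ⊎ [k])* ⇀ Σ*`. -/
def deref (v : List (RefSym A k)) : Option (List A) :=
  derefFrom [] v

end RefSym

namespace PreRewb

variable {A : Type u} {k : ℕ}

/-- The labels occurring in an expression, in references or captures. -/
def var : PreRewb A k → Set (Fin k)
  | eps => ∅
  | letter _ => ∅
  | ref i => {i}
  | concat α β => var α ∪ var β
  | alt α β => var α ∪ var β
  | star α => var α
  | capture j α => var α ∪ {j}

/-- Every capture `(_j α )_j` satisfies `j ∉ var α`. -/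
def WellFormed : PreRewb A k → Prop
  | eps => True
  | letter _ => True
  | ref _ => True
  | concat α β => WellFormed α ∧ WellFormed β
  | alt α β => WellFormed α ∧ WellFormed β
  | star α => WellFormed α
  | capture j α => j ∉ var α ∧ WellFormed α

/-- No reference occurs as a subexpression. -/
def ReferenceFree : PreRewb A k → Prop
  | eps => True
  | letter _ => True
  | ref _ => False
  | concat α β => ReferenceFree α ∧ ReferenceFree β
  | alt α β => ReferenceFree α ∧ ReferenceFree β
  | star α => ReferenceFree α
  | capture _ α => ReferenceFree α

/-- No reference occurs inside a capture. -/
def NoCapturedReference : PreRewb A k → Prop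
  | eps => True
  | letter _ => True
  | ref _ => True
  | concat α β => NoCapturedReference α ∧ NoCapturedReference β
  | alt α β => NoCapturedReference α ∧ NoCapturedReference β
  | star α => NoCapturedReference α
  | capture _ α => ReferenceFree α

/-- The regular language `R_k(α)` over `Σ ⊎ B_k ⊎ [k]`. -/
def refWords : PreRewb A k → Language (RefSym A k)
  | eps => 1
  | letter a => {[RefSym.letter a]}
  | ref i => {[RefSym.ref i]}
  | concat α β => refWords α * refWords β
  | alt α β => refWords α + refWords β
  | star α => (refWords α)∗
  | capture j α => {[RefSym.opening j]} * refWords α * {[RefSym.closing j]}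

end PreRewb

/-- Rewbs over `A`: regular expressions, and `k`-rewbs for `k ≥ 1`. -/
inductive Rewb (A : Type u) : Type u
  | regular (r : RegularExpression A) : Rewb A
  | backref (k : ℕ) (hk : 1 ≤ k) (α : PreRewb A k) (hα : α.WellFormed) : Rewb A

namespace Rewb

variable {A : Type u}

/-- No reference `\i` occurs inside a capture `(_j … )_j`. -/
def NoCapturedReference : Rewb A → Prop
  | regular _ => True
  | backref _ _ α _ => α.NoCapturedReference

/-- The language described by a rewb, `L(α) = { D_k(v) | v ∈ R_k(α) }`. -/
def language : Rewb A → Language A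
  | regular r => r.matches'
  | backref _ _ α _ => {w | ∃ v ∈ α.refWords, RefSym.deref v = some w}

end Rewb

/-! ### One-way nondeterministic stack automata -/

/-- Moves of the input cursor (`S` and `R`). -/
inductive InputMove
  | stay
  | right

/-- Moves of the stack pointer (`L`, `S` and `R`). -/
inductive StackMove
  | left
  | stay
  | right

/-- The remaining input after the cursor, standing on `a` with `u` to its right, moves. -/
def InputMove.apply {A : Type u} : InputMove → A → List A → List A
  | stay, a, u => a :: u
  | right, _, u => u

/-- A one-way nondeterministic stack automaton with input alphabet `A`, states `Q` and stack
symbols `Γ`. The bottom marker `#` and top marker `$` of the stack are implicit. -/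
structure StackAutomaton (A : Type u) (Q Γ : Type) where
  /-- start state -/
  start : Q
  /-- initial stack symbol -/
  initSym : Γ
  /-- final states -/
  final : Set Q
  /-- pushdown mode: `(q', d, w$) ∈ δ(q, a, Z$)` -/
  push : Q → A → Γ → Set (Q × InputMove × List Γ)
  /-- as usual, only finitely many moves are possible in every situation -/
  push_finite : ∀ q a Z, (push q a Z).Finite
  /-- stack reading mode at the top: `(q', d, L) ∈ δ(q, a, Z$)` -/
  readTop : Q → A → Γ → Set (Q × InputMove)
  /-- stack reading mode strictly inside the stack: `(q', d, e) ∈ δ(q, a, Z)` -/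
  readInside : Q → A → Γ → Set (Q × InputMove × StackMove)
  /-- stack reading mode at the bottom: `(q', d, R) ∈ δ(q, a, #)` -/
  readBottom : Q → A → Set (Q × InputMove)

/-- An instantaneous description. The stack `# y₁ ↾ y₂ $`, whose pointer references the last
symbol of `# y₁`, is stored as `left = y₁.reverse` and `right = y₂`. -/
structure StackAutomaton.ID (A : Type u) (Q Γ : Type) where
  /-- current state -/
  state : Q
  /-- remaining input, starting at the cursor -/
  input : List A
  /-- stack symbols up to the pointer, from the pointer down to the bottom -/
  left : List Γ
  /-- stack symbols above the pointer, from the pointer up to the top -/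
  right : List Γ

namespace StackAutomaton

variable {A : Type u} {Q Γ : Type}

/-- One step of computation. -/
inductive Step (M : StackAutomaton A Q Γ) : ID A Q Γ → ID A Q Γ → Prop
  | push {q q' : Q} {a : A} {u : List A} {d : InputMove} {Z : Γ} {w y : List Γ} :
      (q', d, w) ∈ M.push q a Z →
      Step M ⟨q, a :: u, Z :: y, []⟩ ⟨q', d.apply a u, w.reverse ++ y, []⟩
  | readTop {q q' : Q} {a : A} {u : List A} {d : InputMove} {Z : Γ} {y : List Γ} :
      (q', d) ∈ M.readTop q a Z →
      Step M ⟨q, a :: u, Z :: y, []⟩ ⟨q', d.apply a u, y, [Z]⟩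
  | insideLeft {q q' : Q} {a : A} {u : List A} {d : InputMove} {Z Y : Γ} {y z : List Γ} :
      (q', d, StackMove.left) ∈ M.readInside q a Z →
      Step M ⟨q, a :: u, Z :: y, Y :: z⟩ ⟨q', d.apply a u, y, Z :: Y :: z⟩
  | insideStay {q q' : Q} {a : A} {u : List A} {d : InputMove} {Z Y : Γ} {y z : List Γ} :
      (q', d, StackMove.stay) ∈ M.readInside q a Z →
      Step M ⟨q, a :: u, Z :: y, Y :: z⟩ ⟨q', d.apply a u, Z :: y, Y :: z⟩
  | insideRight {q q' : Q} {a : A} {u : List A} {d : InputMove} {Z Y : Γ} {y z : List Γ} :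
      (q', d, StackMove.right) ∈ M.readInside q a Z →
      Step M ⟨q, a :: u, Z :: y, Y :: z⟩ ⟨q', d.apply a u, Y :: Z :: y, z⟩
  | readBottom {q q' : Q} {a : A} {u : List A} {d : InputMove} {Z : Γ} {z : List Γ} :
      (q', d) ∈ M.readBottom q a →
      Step M ⟨q, a :: u, [], Z :: z⟩ ⟨q', d.apply a u, [Z], z⟩

/-- The language `L(M)`: acceptance by final state with the whole input consumed, starting from
the stack `# Z₀ ↾ $`. -/
def language (M : StackAutomaton A Q Γ) : Language A :=
  {w | ∃ qf ∈ M.final, ∃ y z : List Γ,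
    Relation.ReflTransGen M.Step ⟨M.start, w, [M.initSym], []⟩ ⟨qf, [], y, z⟩}

/-- The automaton is nonerasing: `(q', d, w$) ∈ δ(q, a, Z$)` implies `w ∈ Z Γ*`. -/
def Nonerasing (M : StackAutomaton A Q Γ) : Prop :=
  ∀ q a Z q' d w, (q', d, w) ∈ M.push q a Z → ∃ w', w = Z :: w'

end StackAutomaton

/-- `L` is a nonerasing stack language: it is recognized by a nonerasing stack automaton with
finitely many states and stack symbols. -/
def IsNonerasingStackLanguage {A : Type u} (L : Language A) : Prop :=
  ∃ (Q Γ : Type) (_ : Finite Q) (_ : Finite Γ) (M : StackAutomaton A Q Γ),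
    M.Nonerasing ∧ M.language = L

/-- The language `{aⁿ bⁿ | n ∈ ℕ}`. -/
def powPowLanguage {A : Type u} (a b : A) : Language A :=
  {w | ∃ n : ℕ, w = List.replicate n a ++ List.replicate n b}

/-! A stack automaton can write a word of `refWords` on its stack symbol by symbol, guessing it on
the way, while it reads the letters to which the word is dereferenced. At a reference `\i` it leaves
the top of the stack, walks down to the nearest `[_i`, reads the letters from there to the next
`]_i`, and returns to the top. When no reference is captured, the copied part contains no references
itself, so its letters on the stack are all that has to be read. No stack symbol is ever erased.

For `{aⁿ bⁿ}`, cut the dereferencing of a word to `aⁿ bⁿ` after the letters `a`. All that is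
captured so far are powers of `a`, and a nonempty one can never be referenced during the second
part. Hence the second part depends only on the state of an automaton for `refWords` and, for every
label, on whether its capture is open, closed or missing and on whether it is empty. By the
pigeonhole principle two such cuts agree, for `aᵐ bᵐ` and `aⁿ bⁿ` with `m ≠ n`, and recombining them
yields `aᵐ bⁿ`. -/

namespace RegularLanguage

variable {T : Type*} {K L M : Language T} {a : T} {w : List T}

/- Antimirov's criterion: unions of members of `S` are closed under left quotients, and there are
only finitely many of them. -/
theorem isRegular_of_finite_of_cons_mem_iff {S : Set (Language T)} (hS : S.Finite)
    (h : ∀ K ∈ S, ∀ a, ∃ P ⊆ S, ∀ w, a :: w ∈ K ↔ ∃ N ∈ P, w ∈ N) (hL : L ∈ S) :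
    L.IsRegular := by
  let union (P : Set (Language T)) : Language T := {w | ∃ N ∈ P, w ∈ N}
  refine .of_finite_range_leftQuotient ((hS.finite_subsets.image union).subset ?_)
  rintro _ ⟨x, rfl⟩
  induction x generalizing L with
  | nil => exact ⟨{L}, Set.singleton_subset_iff.2 hL, Language.ext fun w => by
      simp only [union, Set.mem_singleton_iff, exists_eq_left]; rfl⟩
  | cons a x ih =>
    obtain ⟨P, hPS, hP⟩ := h L hL a
    choose Q hQS hQ using fun N : P => ih (hPS N.2)
    refine ⟨⋃ N, Q N, Set.iUnion_subset hQS, Language.ext fun w => ?_⟩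
    have hQ' (N : P) : (∃ K' ∈ Q N, w ∈ K') ↔ x ++ w ∈ N.1 := Set.ext_iff.1 (hQ N) w
    change (∃ K' ∈ ⋃ N, Q N, w ∈ K') ↔ a :: (x ++ w) ∈ L
    rw [hP]
    simp only [Set.mem_iUnion, Subtype.exists]
    constructor
    · rintro ⟨K', ⟨N, hN, hK'⟩, hw⟩
      exact ⟨N, hN, (hQ' ⟨N, hN⟩).1 ⟨K', hK', hw⟩⟩
    · rintro ⟨N, hN, hw⟩
      obtain ⟨K', hK', hw⟩ := (hQ' ⟨N, hN⟩).2 hw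
      exact ⟨K', ⟨N, hN, hK'⟩, hw⟩

theorem cons_mem_mul_iff : a :: w ∈ L * M ↔
    w ∈ L.leftQuotient [a] * M ∨ [] ∈ L ∧ w ∈ M.leftQuotient [a] := by
  simp only [Language.mem_mul, Language.mem_leftQuotient, List.singleton_append]
  constructor
  · rintro ⟨_ | ⟨c, x⟩, hx, y, hy, h⟩
    · exact .inr ⟨hx, h ▸ hy⟩
    · obtain ⟨rfl, rfl⟩ := List.cons.inj h
      exact .inl ⟨x, hx, y, hy, rfl⟩
  · rintro (⟨x, hx, y, hy, rfl⟩ | ⟨hnil, hw⟩)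
    · exact ⟨a :: x, hx, y, hy, rfl⟩
    · exact ⟨[], hnil, a :: w, hw, rfl⟩

theorem cons_mem_kstar_iff : a :: w ∈ L∗ ↔ w ∈ L.leftQuotient [a] * L∗ := by
  constructor
  · intro h
    obtain ⟨_ | ⟨_ | ⟨c, x⟩, S⟩, hS, hSL⟩ := Language.mem_kstar_iff_exists_nonempty.1 h
    · simp at hS
    · simp at hSL
    · obtain ⟨rfl, rfl⟩ := List.cons.inj hS
      exact Language.append_mem_mul (hSL _ List.mem_cons_self).1
        (Language.join_mem_kstar fun y hy => (hSL y (List.mem_cons_of_mem _ hy)).1)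
  · rintro ⟨x, hx, _, ⟨S, rfl, hS⟩, rfl⟩
    exact ⟨(a :: x) :: S, rfl, List.forall_mem_cons.2 ⟨hx, hS⟩⟩

theorem kstar_induction {C : List T → Prop} (nil : C []) (append : ∀ v w, C v → C w → C (v ++ w))
    (h : ∀ v ∈ L, C v) : ∀ v ∈ L∗, C v := by
  rintro _ ⟨S, rfl, hS⟩
  induction S with
  | nil => exact nil
  | cons s S ih =>
    obtain ⟨hs, hS⟩ := List.forall_mem_cons.1 hS
    exact append _ _ (h s hs) (ih hS)

theorem zero_isRegular : (0 : Language T).IsRegular :=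
  isRegular_of_finite_of_cons_mem_iff (Set.finite_singleton 0)
    (by rintro _ rfl a; exact ⟨∅, Set.empty_subset _, by simp [Language.notMem_zero]⟩) rfl

theorem one_isRegular : (1 : Language T).IsRegular :=
  isRegular_of_finite_of_cons_mem_iff (Set.finite_singleton 1)
    (by rintro _ rfl a; exact ⟨∅, Set.empty_subset _, by simp [Language.mem_one]⟩) rfl

theorem singleton_isRegular (c : T) : ({[c]} : Language T).IsRegular := by
  refine isRegular_of_finite_of_cons_mem_iff (Set.toFinite {{[c]}, 1}) ?_ (Set.mem_insert _ _)
  rintro _ (rfl | rfl) a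
  · refine ⟨{N | N = 1 ∧ a = c}, fun N hN => .inr hN.1, fun w => ?_⟩
    change a :: w = [c] ↔ _
    simp [Language.mem_one, and_comm]
  · exact ⟨∅, Set.empty_subset _, by simp [Language.mem_one]⟩

theorem leftQuotient_mem_range (hK : K ∈ Set.range L.leftQuotient) :
    K.leftQuotient [a] ∈ Set.range L.leftQuotient := by
  obtain ⟨x, rfl⟩ := hK
  exact ⟨x ++ [a], Language.leftQuotient_append ..⟩

theorem mul_isRegular (hL : L.IsRegular) (hM : M.IsRegular) : (L * M).IsRegular := by
  refine isRegular_of_finite_of_cons_mem_iff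
    ((hL.finite_range_leftQuotient.image (· * M)).union hM.finite_range_leftQuotient) ?_
    (.inl ⟨L, ⟨[], rfl⟩, rfl⟩)
  rintro N (⟨K, hK, rfl⟩ | hN) a
  · refine ⟨{N | N = K.leftQuotient [a] * M ∨ [] ∈ K ∧ N = M.leftQuotient [a]}, ?_, fun w => ?_⟩
    · rintro _ (rfl | ⟨-, rfl⟩)
      · exact .inl ⟨_, leftQuotient_mem_range hK, rfl⟩
      · exact .inr ⟨_, rfl⟩
    · simp [cons_mem_mul_iff, or_and_right, exists_or, and_assoc]
  · exact ⟨{N.leftQuotient [a]}, Set.singleton_subset_iff.2 (.inr (leftQuotient_mem_range hN)),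
      by simp⟩

theorem kstar_isRegular (hL : L.IsRegular) : (L∗).IsRegular := by
  refine isRegular_of_finite_of_cons_mem_iff
    ((hL.finite_range_leftQuotient.image (· * L∗)).insert (L∗)) ?_ (Set.mem_insert _ _)
  have hquot (a : T) :
      L.leftQuotient [a] * L∗ ∈ insert (L∗) ((· * L∗) '' Set.range L.leftQuotient) :=
    .inr ⟨_, ⟨[a], rfl⟩, rfl⟩
  rintro _ (rfl | ⟨K, hK, rfl⟩) a
  · exact ⟨{_}, Set.singleton_subset_iff.2 (hquot a), by
      simp only [Set.mem_singleton_iff, exists_eq_left, cons_mem_kstar_iff, implies_true]⟩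
  · refine ⟨{N | N = K.leftQuotient [a] * L∗ ∨ [] ∈ K ∧ N = L.leftQuotient [a] * L∗}, ?_,
      fun w => ?_⟩
    · rintro _ (rfl | ⟨-, rfl⟩)
      · exact .inr ⟨_, leftQuotient_mem_range hK, rfl⟩
      · exact hquot a
    · simp [cons_mem_mul_iff, cons_mem_kstar_iff, or_and_right, exists_or, and_assoc]

theorem matches'_isRegular (r : RegularExpression T) : r.matches'.IsRegular := by
  induction r with
  | zero => exact zero_isRegular
  | epsilon => exact one_isRegular
  | char c => exact singleton_isRegular c
  | plus r s hr hs => exact hr.add hs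
  | comp r s hr hs => exact mul_isRegular hr hs
  | star r hr => exact kstar_isRegular hr

theorem exists_finite_forall_mem_matches' (r : RegularExpression T) :
    ∃ S : Set T, S.Finite ∧ ∀ v ∈ r.matches', ∀ x ∈ v, x ∈ S := by
  induction r with
  | zero => exact ⟨∅, Set.finite_empty, by rintro _ ⟨⟩⟩
  | epsilon => exact ⟨∅, Set.finite_empty, by rintro _ rfl; simp⟩
  | char c => exact ⟨{c}, Set.finite_singleton c, by rintro _ rfl; simp⟩
  | plus r s hr hs =>
    obtain ⟨S, hS, hrS⟩ := hr
    obtain ⟨S', hS', hsS'⟩ := hs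
    refine ⟨S ∪ S', hS.union hS', ?_⟩
    rintro v (hv | hv) x hx
    exacts [.inl (hrS v hv x hx), .inr (hsS' v hv x hx)]
  | comp r s hr hs =>
    obtain ⟨S, hS, hrS⟩ := hr
    obtain ⟨S', hS', hsS'⟩ := hs
    refine ⟨S ∪ S', hS.union hS', ?_⟩
    rintro _ ⟨v, hv, w, hw, rfl⟩ x hx
    exact (List.mem_append.1 hx).imp (hrS v hv x) (hsS' w hw x)
  | star r hr =>
    obtain ⟨S, hS, hrS⟩ := hr
    refine ⟨S, hS, kstar_induction (by simp) ?_ hrS⟩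
    exact fun v w hv hw => List.forall_mem_append.2 ⟨hv, hw⟩

end RegularLanguage

/-- What the part of a reference word read so far says about one label: no opening bracket has
occurred, the bracket opened last is still open, or it has been closed again. The last two cases
carry the string captured since that bracket. -/
inductive Register (A : Type u) : Type u
  | unset
  | recording (w : List A)
  | stored (w : List A)

namespace Register

variable {A : Type u}

/-- The string held by a register. -/
def content : Register A → List A
  | unset => []
  | recording w => w
  | stored w => w

/-- The string that replaces a reference to a register, if it is defined. -/
def value : Register A → Option (List A)
  | unset => some []
  | recording _ => none
  | stored w => some w

/-- Let a register take note of the output `c`. -/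
def append (c : List A) : Register A → Register A
  | recording w => recording (w ++ c)
  | r => r

/-- The effect of a closing bracket on its register. -/
def close : Register A → Register A
  | recording w => stored w
  | r => r

theorem append_nil (r : Register A) : r.append [] = r := by
  cases r <;> simp [append]

theorem content_append_subset (c : List A) (r : Register A) :
    (r.append c).content ⊆ r.content ++ c := by
  cases r <;> simp [append, content]

theorem content_close (r : Register A) : r.close.content = r.content := by
  cases r <;> rfl

theorem content_of_value_eq_some {r : Register A} {c : List A} (h : r.value = some c) :
    r.content = c := by
  cases r <;> simp_all [value, content]

end Register

namespace RefSym

variable {A : Type u} {k : ℕ} {i : Fin k} {p : List (RefSym A k)} {x : RefSym A k}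
  {ρ : Fin k → Register A} {c : List A}

theorem eraseBrackets_append (v w : List (RefSym A k)) :
    eraseBrackets (v ++ w) = eraseBrackets v ++ eraseBrackets w :=
  List.filterMap_append

theorem eraseBrackets_map_letter (w : List A) :
    eraseBrackets (w.map letter : List (RefSym A k)) = w := by
  simp [eraseBrackets, List.filterMap_map, Function.comp_def, toLetter?]

theorem isOpening_iff : isOpening i x = true ↔ x = opening i := by
  cases x <;> simp [isOpening]

theorem isClosing_iff : isClosing i x = true ↔ x = closing i := by
  cases x <;> simp [isClosing]

theorem any_isOpening_iff {v : List (RefSym A k)} : v.any (isOpening i) ↔ opening i ∈ v := by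
  simp [isOpening_iff]

theorem any_isClosing_iff {v : List (RefSym A k)} : v.any (isClosing i) ↔ closing i ∈ v := by
  simp [isClosing_iff]

theorem afterLastOpening_append_opening_append {z : List (RefSym A k)} (hz : opening i ∉ z) :
    afterLastOpening i (p ++ opening i :: z) = z := by
  have hz' : ∀ x ∈ z.reverse, (!isOpening i x) = true := by
    rintro x hx
    rw [Bool.not_eq_true', Bool.eq_false_iff, Ne, isOpening_iff]
    rintro rfl
    exact hz (List.mem_reverse.1 hx)
  rw [afterLastOpening, List.reverse_append, List.reverse_cons, List.append_assoc,
    List.takeWhile_append_of_pos hz', List.singleton_append,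
    List.takeWhile_cons_of_neg (by simp [isOpening]), List.append_nil, List.reverse_reverse]

theorem takeWhile_not_isClosing_append {y z : List (RefSym A k)} (hy : closing i ∉ y) :
    ((y ++ closing i :: z).takeWhile fun x => !isClosing i x) = y := by
  have hy' : ∀ x ∈ y, (!isClosing i x) = true := by
    rintro x hx
    rw [Bool.not_eq_true', Bool.eq_false_iff, Ne, isClosing_iff]
    rintro rfl
    exact hy hx
  rw [List.takeWhile_append_of_pos hy', List.takeWhile_cons_of_neg (by simp [isClosing]),
    List.append_nil]

/-- The register of the label `i` after the string `p`. -/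
def register (p : List (RefSym A k)) (i : Fin k) : Register A :=
  if p.any (isOpening i) then
    if (afterLastOpening i p).any (isClosing i) then
      .stored (eraseBrackets ((afterLastOpening i p).takeWhile fun x => !isClosing i x))
    else .recording (eraseBrackets (afterLastOpening i p))
  else .unset

theorem capturedValue_eq_value_register : capturedValue i p = (register p i).value := by
  unfold capturedValue register
  split_ifs <;> rfl

theorem register_of_opening_notMem (hp : opening i ∉ p) : register p i = .unset :=
  if_neg (mt any_isOpening_iff.1 hp)

theorem register_append_opening_of_closing_notMem {z : List (RefSym A k)} (hz : opening i ∉ z)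
    (hz' : closing i ∉ z) : register (p ++ opening i :: z) i = .recording (eraseBrackets z) := by
  rw [register, if_pos (any_isOpening_iff.2 (by simp)), afterLastOpening_append_opening_append hz,
    if_neg (mt any_isClosing_iff.1 hz')]

theorem register_append_opening_append_closing {y z : List (RefSym A k)} (hy : closing i ∉ y)
    (hyz : opening i ∉ y ++ closing i :: z) :
    register (p ++ opening i :: (y ++ closing i :: z)) i = .stored (eraseBrackets y) := by
  rw [register, if_pos (any_isOpening_iff.2 (by simp)), afterLastOpening_append_opening_append hyz,
    if_pos (any_isClosing_iff.2 (by simp)), takeWhile_not_isClosing_append hy]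

theorem exists_eq_append_last_opening (hp : opening i ∈ p) :
    ∃ q z, p = q ++ opening i :: z ∧ opening i ∉ z := by
  obtain ⟨z, q, h, hz⟩ := List.eq_append_cons_of_mem (List.mem_reverse.2 hp)
  exact ⟨q.reverse, z.reverse, by simpa using congrArg List.reverse h, by simpa using hz⟩

theorem register_append {v : List (RefSym A k)} (hopen : opening i ∉ v) (hclose : closing i ∉ v) :
    register (p ++ v) i = (register p i).append (eraseBrackets v) := by
  by_cases hp : opening i ∈ p
  · obtain ⟨q, z, rfl, hz⟩ := exists_eq_append_last_opening hp
    rw [List.append_assoc, List.cons_append]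
    by_cases hz' : closing i ∈ z
    · obtain ⟨y, t, rfl, hy⟩ := List.eq_append_cons_of_mem hz'
      rw [register_append_opening_append_closing hy hz, List.append_assoc, List.cons_append,
        register_append_opening_append_closing hy (by simp_all)]
      rfl
    · rw [register_append_opening_of_closing_notMem hz hz',
        register_append_opening_of_closing_notMem (by simp_all) (by simp_all),
        eraseBrackets_append]
      rfl
  · rw [register_of_opening_notMem hp, register_of_opening_notMem (by simp_all)]
    rfl

theorem register_append_ref (j : Fin k) : register (p ++ [ref j]) = register p :=
  funext fun _ => (register_append (by simp) (by simp)).trans (Register.append_nil _)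

theorem register_append_closing : register (p ++ [closing i]) i = (register p i).close := by
  by_cases hp : opening i ∈ p
  · obtain ⟨q, z, rfl, hz⟩ := exists_eq_append_last_opening hp
    rw [List.append_assoc, List.cons_append]
    by_cases hz' : closing i ∈ z
    · obtain ⟨y, t, rfl, hy⟩ := List.eq_append_cons_of_mem hz'
      rw [register_append_opening_append_closing hy hz, List.append_assoc, List.cons_append,
        register_append_opening_append_closing hy (by simp_all)]
      rfl
    · rw [register_append_opening_of_closing_notMem hz hz',
        register_append_opening_append_closing hz' (by simp_all)]
      rfl
  · rw [register_of_opening_notMem hp, register_of_opening_notMem (by simp_all)]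
    rfl

/-- The registers `ρ` after a symbol that produces the output `c`. -/
def record (x : RefSym A k) (c : List A) (ρ : Fin k → Register A) : Fin k → Register A :=
  match x with
  | opening i => Function.update ρ i (.recording [])
  | closing i => Function.update ρ i (ρ i).close
  | letter _ | ref _ => fun i => (ρ i).append c

/-- The output produced by a symbol, if it is defined. -/
def output (x : RefSym A k) (ρ : Fin k → Register A) : Option (List A) :=
  match x with
  | letter a => some [a]
  | ref i => (ρ i).value
  | opening _ | closing _ => some []

/-- The symbols that dereferencing puts in the place of a symbol with output `c`. -/
def expand (x : RefSym A k) (c : List A) : List (RefSym A k) :=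
  match x with
  | ref _ => c.map letter
  | x => [x]

theorem derefFrom_cons (v : List (RefSym A k)) :
    derefFrom p (x :: v) = (x.output (register p)).bind fun c => derefFrom (p ++ x.expand c) v := by
  cases x with
  | ref i =>
    rw [derefFrom, capturedValue_eq_value_register, output]
    cases (register p i).value <;> rfl
  | _ => simp only [derefFrom, output, expand, Option.bind_some]

theorem eraseBrackets_expand (hc : x.output ρ = some c) : eraseBrackets (x.expand c) = c := by
  cases x with
  | ref i => exact eraseBrackets_map_letter c
  | letter a | opening i | closing i => rw [← Option.some_inj, ← hc]; rfl

theorem register_append_expand (hc : x.output ρ = some c) :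
    register (p ++ x.expand c) = x.record c (register p) := by
  funext j
  cases x with
  | letter a =>
    rw [register_append (by simp [expand]) (by simp [expand]), eraseBrackets_expand hc, record]
  | ref i =>
    rw [register_append (by simp [expand]) (by simp [expand]), eraseBrackets_expand hc, record]
  | opening i =>
    rcases eq_or_ne j i with rfl | hj
    · simp [expand, record, register_append_opening_of_closing_notMem, eraseBrackets]
    · rw [register_append (by simpa [expand] using hj) (by simp [expand]), record,
        Function.update_of_ne hj]
      exact Register.append_nil _
  | closing i =>
    rcases eq_or_ne j i with rfl | hj
    · simp [expand, record, register_append_closing]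
    · rw [register_append (by simp [expand]) (by simpa [expand] using hj), record,
        Function.update_of_ne hj]
      exact Register.append_nil _

/-- `Run ρ v w ρ'`: with the registers `ρ`, the string `v` is dereferenced to `w`, and this leaves
the registers `ρ'`. -/
inductive Run :
    (Fin k → Register A) → List (RefSym A k) → List A → (Fin k → Register A) → Prop
  | nil {ρ : Fin k → Register A} : Run ρ [] [] ρ
  | cons {ρ ρ' : Fin k → Register A} {x v c w} :
      x.output ρ = some c → Run (x.record c ρ) v w ρ' → Run ρ (x :: v) (c ++ w) ρ'

theorem derefFrom_eq_some_iff {v : List (RefSym A k)} {w : List A} :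
    derefFrom p v = some w ↔ ∃ u ρ, Run (register p) v u ρ ∧ eraseBrackets p ++ u = w := by
  induction v generalizing p with
  | nil =>
    rw [derefFrom, Option.some_inj]
    constructor
    · exact fun h => ⟨[], _, .nil, by rw [List.append_nil, h]⟩
    · rintro ⟨_, _, ⟨⟩, h⟩
      rw [← h, List.append_nil]
  | cons x v ih =>
    rw [derefFrom_cons, Option.bind_eq_some_iff]
    constructor
    · rintro ⟨c, hc, h⟩
      obtain ⟨u, ρ, hu, rfl⟩ := ih.1 h
      rw [register_append_expand hc] at hu
      exact ⟨c ++ u, ρ, .cons hc hu, by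
        rw [eraseBrackets_append, eraseBrackets_expand hc, List.append_assoc]⟩
    · rintro ⟨_, ρ, ⟨⟩ | ⟨hc, hu⟩, rfl⟩
      rw [← register_append_expand hc] at hu
      refine ⟨_, hc, ih.2 ⟨_, ρ, hu, ?_⟩⟩
      rw [eraseBrackets_append, eraseBrackets_expand hc, List.append_assoc]

theorem deref_eq_some_iff {v : List (RefSym A k)} {w : List A} :
    deref v = some w ↔ ∃ ρ, Run (fun _ => .unset) v w ρ := by
  rw [deref, derefFrom_eq_some_iff]
  constructor
  · rintro ⟨_, ρ, h, rfl⟩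
    exact ⟨ρ, h⟩
  · exact fun ⟨ρ, h⟩ => ⟨w, ρ, h, rfl⟩

end RefSym

namespace Register

variable {A : Type u} {a : A} {r r' : Register A} {c : List A}

/-- Whether a register is recording or stored (`none` if it is unset), and whether its content is
empty. -/
def shape : Register A → Option (Bool × Bool)
  | unset => none
  | recording w => some (true, w.isEmpty)
  | stored w => some (false, w.isEmpty)

/-- Registers that cannot be told apart as long as the letter `a` is not put out. -/
inductive Agree (a : A) : Register A → Register A → Prop
  | refl {r : Register A} : Agree a r r
  | recording {w w' : List A} : a ∈ w → a ∈ w' → Agree a (recording w) (recording w')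
  | stored {w w' : List A} : a ∈ w → a ∈ w' → Agree a (stored w) (stored w')

theorem Agree.append (h : Agree a r r') (c : List A) : Agree a (r.append c) (r'.append c) := by
  cases h with
  | refl => exact .refl
  | recording h h' => exact .recording (List.mem_append_left c h) (List.mem_append_left c h')
  | stored h h' => exact .stored h h'

theorem Agree.close (h : Agree a r r') : Agree a r.close r'.close := by
  cases h with
  | refl => exact .refl
  | recording h h' => exact .stored h h'
  | stored h h' => exact .stored h h'

theorem Agree.value_eq_some (h : Agree a r r') (hr : r.value = some c) (ha : a ∉ c) :
    r'.value = some c := by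
  cases h with
  | refl => exact hr
  | recording => simp [value] at hr
  | stored h => exact (ha (Option.some.inj hr ▸ h)).elim

theorem agree_of_shape_eq (h : ∀ b ∈ r.content, b = a) (h' : ∀ b ∈ r'.content, b = a)
    (hshape : r.shape = r'.shape) : Agree a r r' := by
  have mem_of_ne_nil {w : List A} (hw : ∀ b ∈ w, b = a) (hne : w ≠ []) : a ∈ w := by
    obtain ⟨b, hb⟩ := List.exists_mem_of_ne_nil w hne
    exact hw b hb ▸ hb
  rcases r with _ | w | w <;> rcases r' with _ | w' | w' <;>
    simp only [shape, Option.some_inj, Prod.mk.injEq, reduceCtorEq, true_and, false_and] at hshape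
  · exact .refl
  all_goals
    rcases eq_or_ne w [] with rfl | hw
    · obtain rfl : w' = [] := by simpa using hshape.symm
      exact .refl
    · have hw' : w' ≠ [] := by rintro rfl; simp_all
      constructor
      exacts [mem_of_ne_nil h hw, mem_of_ne_nil h' hw']

end Register

namespace RefSym

variable {A : Type u} {k : ℕ} {ρ ρ' σ : Fin k → Register A} {x : RefSym A k}
  {v : List (RefSym A k)} {c w w₁ w₂ : List A} {s : Set A} {a : A}

theorem Run.append {τ : Fin k → Register A} {v₁ v₂ : List (RefSym A k)} (h₁ : Run ρ v₁ w₁ σ)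
    (h₂ : Run σ v₂ w₂ τ) : Run ρ (v₁ ++ v₂) (w₁ ++ w₂) τ := by
  induction h₁ with
  | nil => exact h₂
  | cons hc _ ih => exact List.append_assoc .. ▸ .cons hc (ih h₂)

theorem content_record_subset (hρ : ∀ i, ∀ b ∈ (ρ i).content, b ∈ s) (hc : ∀ b ∈ c, b ∈ s)
    (i : Fin k) : ∀ b ∈ (x.record c ρ i).content, b ∈ s := by
  have happend : ∀ b ∈ ((ρ i).append c).content, b ∈ s := fun b hb =>
    (List.mem_append.1 (Register.content_append_subset c (ρ i) hb)).elim (hρ i b) (hc b)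
  cases x with
  | letter | ref => exact happend
  | opening j =>
    rcases eq_or_ne i j with rfl | hij
    · simp [record, Register.content]
    · simpa only [record, Function.update_of_ne hij] using hρ i
  | closing j =>
    rcases eq_or_ne i j with rfl | hij
    · simpa only [record, Function.update_self, Register.content_close] using hρ i
    · simpa only [record, Function.update_of_ne hij] using hρ i

theorem Run.content_subset (h : Run ρ v w ρ') (hρ : ∀ i, ∀ b ∈ (ρ i).content, b ∈ s)
    (hw : ∀ b ∈ w, b ∈ s) (i : Fin k) : ∀ b ∈ (ρ' i).content, b ∈ s := by
  induction h with
  | nil => exact hρ i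
  | cons _ _ ih =>
    rw [List.forall_mem_append] at hw
    exact ih (content_record_subset hρ hw.1) hw.2

theorem output_subset_or_singleton (hc : x.output ρ = some c) :
    (∃ i, c = (ρ i).content) ∨ c.length ≤ 1 := by
  cases x with
  | ref i => exact .inl ⟨i, (Register.content_of_value_eq_some hc).symm⟩
  | letter | opening | closing => exact .inr (by simp [← Option.some.inj hc])

/- A reference cannot produce a string that straddles the border between `w₁` and `w₂`, since its
register does not hold letters of `w₂` yet. -/
theorem Run.exists_cut (h : Run ρ v (w₁ ++ w₂) ρ') (hρ : ∀ i, ∀ b ∈ (ρ i).content, b ∈ s)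
    (hw₁ : ∀ b ∈ w₁, b ∈ s) (hw₂ : ∀ b ∈ w₂, b ∉ s) :
    ∃ v₁ v₂ σ, v = v₁ ++ v₂ ∧ Run ρ v₁ w₁ σ ∧ Run σ v₂ w₂ ρ' := by
  generalize hw : w₁ ++ w₂ = w at h
  induction h generalizing w₁ with
  | nil =>
    obtain ⟨rfl, rfl⟩ := List.append_eq_nil_iff.1 hw
    exact ⟨[], [], _, rfl, .nil, .nil⟩
  | @cons ρ ρ' x v c w hc hrun ih =>
    have hrec {t : List A} (ht : w₁ = c ++ t) (hw : t ++ w₂ = w) :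
        ∃ v₁ v₂ σ, x :: v = v₁ ++ v₂ ∧ Run ρ v₁ w₁ σ ∧ Run σ v₂ w₂ ρ' := by
      rw [ht, List.forall_mem_append] at hw₁
      obtain ⟨v₁, v₂, σ, rfl, h₁, h₂⟩ := ih (content_record_subset hρ hw₁.1) hw₁.2 hw
      exact ⟨x :: v₁, v₂, σ, rfl, ht ▸ .cons hc h₁, h₂⟩
    rcases List.append_eq_append_iff.1 hw with ⟨t, ht, ht'⟩ | ⟨t, ht, ht'⟩
    · rcases eq_or_ne t [] with rfl | hne
      · exact hrec (t := []) (by simpa using ht.symm) (by simpa using ht')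
      obtain ⟨b, hb⟩ := List.exists_mem_of_ne_nil t hne
      have hbs : b ∉ s := hw₂ b (ht' ▸ List.mem_append_left w hb)
      have hbc : b ∈ c := ht ▸ List.mem_append_right w₁ hb
      rcases output_subset_or_singleton hc with ⟨i, rfl⟩ | hlength
      · exact absurd (hρ i b hbc) hbs
      · have hlength' : w₁.length + t.length ≤ 1 := by simpa [ht] using hlength
        obtain rfl : w₁ = [] := List.length_eq_zero_iff.1 (by
          have := List.length_pos_of_ne_nil hne; omega)
        exact ⟨[], x :: v, ρ, rfl, .nil, by
          rw [show w₂ = c ++ w from hw]; exact .cons hc hrun⟩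
    · exact hrec ht ht'.symm

theorem agree_record (h : ∀ i, Register.Agree a (ρ i) (σ i)) (i : Fin k) :
    Register.Agree a (x.record c ρ i) (x.record c σ i) := by
  cases x with
  | letter | ref => exact (h i).append c
  | opening j =>
    rcases eq_or_ne i j with rfl | hij
    · simpa only [record, Function.update_self] using .refl
    · simpa only [record, Function.update_of_ne hij] using h i
  | closing j =>
    rcases eq_or_ne i j with rfl | hij
    · simpa only [record, Function.update_self] using (h i).close
    · simpa only [record, Function.update_of_ne hij] using h i

theorem output_eq_some_of_agree (h : ∀ i, Register.Agree a (ρ i) (σ i))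
    (hc : x.output ρ = some c) (ha : a ∉ c) : x.output σ = some c := by
  cases x with
  | ref i => exact (h i).value_eq_some hc ha
  | letter | opening | closing => exact hc

theorem Run.exists_of_agree (hrun : Run ρ v w ρ') (ha : a ∉ w)
    (h : ∀ i, Register.Agree a (ρ i) (σ i)) : ∃ σ', Run σ v w σ' := by
  induction hrun generalizing σ with
  | nil => exact ⟨σ, .nil⟩
  | cons hc _ ih =>
    rw [List.mem_append, not_or] at ha
    obtain ⟨σ', hσ'⟩ := ih ha.2 (agree_record h)
    exact ⟨σ', .cons (output_eq_some_of_agree h hc ha.1) hσ'⟩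

/- At the border between `u i` and `w i`, only the state of an automaton for `R` and the shapes of
the registers matter for the rest of the run. -/
theorem exists_deref_eq_append_of_infinite {R : Language (RefSym A k)} (hR : R.IsRegular)
    {ι : Type*} [Infinite ι] {u w : ι → List A} (hu : ∀ n, ∀ b ∈ u n, b = a)
    (hw : ∀ n, a ∉ w n) (h : ∀ n, ∃ v ∈ R, deref v = some (u n ++ w n)) :
    ∃ m n, m ≠ n ∧ ∃ v ∈ R, deref v = some (u m ++ w n) := by
  obtain ⟨S, _, M, rfl⟩ := hR
  have hcut (n : ι) : ∃ v₁ v₂ ρ, v₁ ++ v₂ ∈ M.accepts ∧ Run (fun _ => .unset) v₁ (u n) ρ ∧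
      ∃ ρ', Run ρ v₂ (w n) ρ' := by
    obtain ⟨v, hv, hvn⟩ := h n
    obtain ⟨ρ', hρ'⟩ := deref_eq_some_iff.1 hvn
    obtain ⟨v₁, v₂, ρ, rfl, h₁, h₂⟩ := hρ'.exists_cut (s := {a}) (by simp [Register.content])
      (hu n) (fun b hb hba => hw n (hba ▸ hb))
    exact ⟨v₁, v₂, ρ, hv, h₁, ρ', h₂⟩
  choose v₁ v₂ ρ hv h₁ ρ' h₂ using hcut
  obtain ⟨m, n, hmn, heq⟩ := Finite.exists_ne_map_eq_of_infinite
    fun n => (M.eval (v₁ n), fun i => (ρ n i).shape)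
  obtain ⟨hstate, hshape⟩ := Prod.mk.inj heq
  have hcontent (n : ι) := (h₁ n).content_subset (s := {a}) (by simp [Register.content]) (hu n)
  obtain ⟨σ', hσ'⟩ := (h₂ n).exists_of_agree (hw n) fun i =>
    Register.agree_of_shape_eq (hcontent n i) (hcontent m i) (congrFun hshape i).symm
  have haccepts (m : ι) :
      v₁ m ++ v₂ n ∈ M.accepts ↔ M.evalFrom (M.eval (v₁ m)) (v₂ n) ∈ M.accept := by
    rw [DFA.mem_accepts, DFA.eval, DFA.evalFrom_of_append]
  refine ⟨m, n, hmn, v₁ m ++ v₂ n, ?_, deref_eq_some_iff.2 ⟨σ', (h₁ m).append hσ'⟩⟩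
  rw [haccepts, hstate, ← haccepts]
  exact hv n

end RefSym

namespace RefSym

variable {A : Type u} {k : ℕ} {i : Fin k} {p u v : List (RefSym A k)} {x : RefSym A k}
  {c w : List A}

/-- Every opening bracket of `v` is followed by a closing bracket with the same label, so that all
references after `v` are defined. -/
def Settled (v : List (RefSym A k)) : Prop :=
  ∀ v₁ i v₂, v = v₁ ++ opening i :: v₂ → closing i ∈ v₂

/-- No reference of `v` is met while a bracket is open; this is what remains in the words of
`refWords` of the condition that no reference is captured. -/
def NoOpenReference (v : List (RefSym A k)) : Prop :=
  ∀ v₁ j v₂, v = v₁ ++ ref j :: v₂ → Settled v₁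

theorem settled_of_opening_notMem (hv : ∀ i, opening i ∉ v) : Settled v := by
  rintro v₁ i v₂ rfl
  exact absurd (by simp) (hv i)

theorem noOpenReference_of_ref_notMem (hv : ∀ i, ref i ∉ v) : NoOpenReference v := by
  rintro v₁ i v₂ rfl
  exact absurd (by simp) (hv i)

theorem Settled.append (hu : Settled u) (hv : Settled v) : Settled (u ++ v) := by
  intro v₁ i v₂ h
  rcases List.append_eq_append_iff.1 h with ⟨t, rfl, ht⟩ | ⟨_ | ⟨x, t⟩, ht, ht'⟩
  · exact hv t i v₂ ht
  · exact hv [] i v₂ ht'.symm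
  · obtain ⟨rfl, rfl⟩ := List.cons.inj ht'
    exact List.mem_append_left v (hu v₁ i t ht)

theorem NoOpenReference.append (hu : NoOpenReference u) (hu' : Settled u)
    (hv : NoOpenReference v) : NoOpenReference (u ++ v) := by
  intro v₁ j v₂ h
  rcases List.append_eq_append_iff.1 h with ⟨t, rfl, ht⟩ | ⟨_ | ⟨x, t⟩, ht, ht'⟩
  · exact hu'.append (hv t j v₂ ht)
  · rw [List.append_nil] at ht
    exact ht ▸ hu'
  · obtain ⟨rfl, rfl⟩ := List.cons.inj ht'
    exact hu v₁ j t ht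

theorem Settled.register_append (hp : Settled p) (i : Fin k) (c : List A) :
    (register p i).append c = register p i := by
  by_cases hi : opening i ∈ p
  · obtain ⟨q, z, rfl, hz⟩ := exists_eq_append_last_opening hi
    obtain ⟨y, t, rfl, hy⟩ := List.eq_append_cons_of_mem (hp q i z rfl)
    rw [register_append_opening_append_closing hy hz]
    rfl
  · rw [register_of_opening_notMem hi]
    rfl

theorem register_append_singleton (hc : x.output (register p) = some c)
    (hp : ∀ j, x = ref j → Settled p) : register (p ++ [x]) = x.record c (register p) := by
  cases x with
  | letter | opening | closing => exact register_append_expand hc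
  | ref i =>
    funext j
    rw [register_append (by simp) (by simp)]
    simp only [record, (hp i rfl).register_append]

/-- `Emits p v w`: after the string `p`, the string `v` is dereferenced to `w`, where the registers
are read off a string in which references are not replaced. -/
inductive Emits : List (RefSym A k) → List (RefSym A k) → List A → Prop
  | nil {p : List (RefSym A k)} : Emits p [] []
  | cons {p : List (RefSym A k)} {x v c w} :
      x.output (register p) = some c → Emits (p ++ [x]) v w → Emits p (x :: v) (c ++ w)

theorem emits_iff_exists_run (h : ∀ v₁ j v₂, v = v₁ ++ ref j :: v₂ → Settled (p ++ v₁)) :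
    Emits p v w ↔ ∃ ρ, Run (register p) v w ρ := by
  induction v generalizing p w with
  | nil =>
    constructor
    · rintro ⟨⟩
      exact ⟨_, .nil⟩
    · rintro ⟨_, ⟨⟩⟩
      exact .nil
  | cons x v ih =>
    have hx (j : Fin k) (hj : x = ref j) : Settled p := by
      simpa using h [] j v (by rw [hj, List.nil_append])
    replace ih {w : List A} : Emits (p ++ [x]) v w ↔ ∃ ρ, Run (register (p ++ [x])) v w ρ :=
      ih fun v₁ j v₂ hv => by simpa using h (x :: v₁) j v₂ (by rw [hv, List.cons_append])
    constructor
    · rintro (_ | ⟨hc, hw⟩)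
      obtain ⟨ρ, hρ⟩ := ih.1 hw
      exact ⟨ρ, .cons hc (register_append_singleton hc hx ▸ hρ)⟩
    · rintro ⟨ρ, ⟨⟩ | ⟨hc, hw⟩⟩
      exact .cons hc (ih.2 ⟨ρ, register_append_singleton hc hx ▸ hw⟩)

theorem NoOpenReference.emits_iff (hv : NoOpenReference v) :
    Emits [ref i] v w ↔ deref v = some w := by
  have hregister : register ([ref i] : List (RefSym A k)) = fun _ => .unset :=
    funext fun j => register_of_opening_notMem (by simp)
  rw [deref_eq_some_iff, ← hregister]
  exact emits_iff_exists_run fun v₁ j v₂ h =>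
    (settled_of_opening_notMem (by simp)).append (hv v₁ j v₂ h)

end RefSym

namespace PreRewb

open RefSym RegularLanguage

variable {A : Type u} {k : ℕ} {α : PreRewb A k}

/-- The regular expression that is obtained by reading references and brackets as symbols. -/
def toRegularExpression : PreRewb A k → RegularExpression (RefSym A k)
  | eps => 1
  | letter a => .char (.letter a)
  | ref i => .char (.ref i)
  | concat α β => toRegularExpression α * toRegularExpression β
  | alt α β => toRegularExpression α + toRegularExpression β
  | star α => .star (toRegularExpression α)
  | capture j α => .char (.opening j) * toRegularExpression α * .char (.closing j)

theorem matches'_toRegularExpression (α : PreRewb A k) :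
    α.toRegularExpression.matches' = α.refWords := by
  induction α <;> simp_all [toRegularExpression, refWords]

theorem settled_of_mem_refWords : ∀ v ∈ α.refWords, Settled v := by
  induction α with
  | eps | letter a | ref i =>
    rintro _ rfl
    exact settled_of_opening_notMem (by simp)
  | concat α β hα hβ =>
    rintro _ ⟨v, hv, w, hw, rfl⟩
    exact (hα v hv).append (hβ w hw)
  | alt α β hα hβ =>
    rintro v (hv | hv)
    exacts [hα v hv, hβ v hv]
  | star α hα =>
    exact kstar_induction (settled_of_opening_notMem (by simp)) (fun _ _ => Settled.append) hα
  | capture j α hα =>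
    rintro _ ⟨_, ⟨_, rfl, v, hv, rfl⟩, _, rfl, rfl⟩
    rintro (_ | ⟨x, v₁⟩) i v₂ h
    · obtain ⟨hij, rfl⟩ := List.cons.inj h
      simp [opening.inj hij]
    · exact (hα v hv).append (settled_of_opening_notMem (by simp)) v₁ i v₂ (List.cons.inj h).2

theorem ReferenceFree.ref_notMem (hα : α.ReferenceFree) (i : Fin k) :
    ∀ v ∈ α.refWords, .ref i ∉ v := by
  induction α with
  | eps | letter a =>
    rintro _ rfl
    simp
  | ref i => exact hα.elim
  | concat α β ihα ihβ =>
    rintro _ ⟨v, hv, w, hw, rfl⟩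
    simpa using ⟨ihα hα.1 v hv, ihβ hα.2 w hw⟩
  | alt α β ihα ihβ =>
    rintro v (hv | hv)
    exacts [ihα hα.1 v hv, ihβ hα.2 v hv]
  | star α ihα =>
    exact kstar_induction (by simp) (fun v w hv hw => by simpa using ⟨hv, hw⟩) (ihα hα)
  | capture j α ihα =>
    rintro _ ⟨_, ⟨_, rfl, v, hv, rfl⟩, _, rfl, rfl⟩
    simpa using ihα hα v hv

theorem NoCapturedReference.noOpenReference (hα : α.NoCapturedReference) :
    ∀ v ∈ α.refWords, NoOpenReference v := by
  induction α with
  | eps | letter a =>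
    rintro _ rfl
    exact noOpenReference_of_ref_notMem (by simp)
  | ref i =>
    rintro _ rfl (_ | ⟨x, v₁⟩) j v₂ h
    · exact settled_of_opening_notMem (by simp)
    · simp at h
  | concat α β ihα ihβ =>
    rintro _ ⟨v, hv, w, hw, rfl⟩
    exact (ihα hα.1 v hv).append (settled_of_mem_refWords v hv) (ihβ hα.2 w hw)
  | alt α β ihα ihβ =>
    rintro v (hv | hv)
    exacts [ihα hα.1 v hv, ihβ hα.2 v hv]
  | star α ihα =>
    refine fun v hv =>
      (kstar_induction (C := fun v => Settled v ∧ NoOpenReference v) ?_ ?_ ?_ v hv).2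
    · exact ⟨settled_of_opening_notMem (by simp), noOpenReference_of_ref_notMem (by simp)⟩
    · exact fun v w hv hw => ⟨hv.1.append hw.1, hv.2.append hv.1 hw.2⟩
    · exact fun v hv => ⟨settled_of_mem_refWords v hv, ihα hα v hv⟩
  | capture j α _ =>
    exact fun v hv => noOpenReference_of_ref_notMem fun i =>
      ReferenceFree.ref_notMem (α := .capture j α) hα i v hv

end PreRewb

instance : Finite InputMove :=
  Finite.of_surjective (fun b : Bool => if b then .stay else .right) fun d => by
    cases d
    exacts [⟨true, rfl⟩, ⟨false, rfl⟩]

namespace StackAutomaton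

variable {A : Type u} {Q Γ : Type}

theorem of_mem_language {M : StackAutomaton A Q Γ} {P : ID A Q Γ → Prop} {w : List A}
    (final : ∀ q ∈ M.final, ∀ y z, P ⟨q, [], y, z⟩) (step : ∀ c c', M.Step c c' → P c' → P c)
    (hw : w ∈ M.language) : P ⟨M.start, w, [M.initSym], []⟩ := by
  obtain ⟨q, hq, y, z, h⟩ := hw
  generalize (⟨M.start, w, [M.initSym], []⟩ : ID A Q Γ) = c at h ⊢
  induction h using Relation.ReflTransGen.head_induction_on with
  | refl => exact final q hq y z
  | head h _ ih => exact step _ _ h ih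

variable [Finite Q] [Finite Γ]

/-- The stack automaton whose moves in pushdown mode, given by `append`, put at most one new symbol
on the stack and do not depend on the topmost symbol. -/
def ofAppend (start : Q) (initSym : Γ) (final : Set Q)
    (append : Q → A → Set (Q × InputMove × Option Γ)) (readTop : Q → A → Γ → Set (Q × InputMove))
    (readInside : Q → A → Γ → Set (Q × InputMove × StackMove))
    (readBottom : Q → A → Set (Q × InputMove)) : StackAutomaton A Q Γ where
  start := start
  initSym := initSym
  final := final
  push q a Z := {m | ∃ o, (m.1, m.2.1, o) ∈ append q a ∧ m.2.2 = Z :: o.toList}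
  push_finite q a Z := by
    refine (Set.finite_range fun m : Q × InputMove × Option Γ =>
      (m.1, m.2.1, Z :: m.2.2.toList)).subset ?_
    rintro ⟨q', d, w⟩ ⟨o, -, rfl⟩
    exact ⟨(q', d, o), rfl⟩
  readTop := readTop
  readInside := readInside
  readBottom := readBottom

section

variable {start : Q} {initSym : Γ} {final : Set Q}
  {append : Q → A → Set (Q × InputMove × Option Γ)} {readTop : Q → A → Γ → Set (Q × InputMove)}
  {readInside : Q → A → Γ → Set (Q × InputMove × StackMove)}
  {readBottom : Q → A → Set (Q × InputMove)}

theorem nonerasing_ofAppend :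
    (ofAppend start initSym final append readTop readInside readBottom).Nonerasing := by
  rintro _ _ _ _ _ _ ⟨o, -, rfl⟩
  exact ⟨_, rfl⟩

theorem step_ofAppend_append {q q' : Q} {a : A} {u : List A} {d : InputMove} {o : Option Γ} {Z : Γ}
    {y : List Γ} (h : (q', d, o) ∈ append q a) :
    (ofAppend start initSym final append readTop readInside readBottom).Step
      ⟨q, a :: u, Z :: y, []⟩ ⟨q', d.apply a u, o.toList ++ Z :: y, []⟩ := by
  cases o
  exacts [.push (w := [Z]) ⟨_, h, rfl⟩, .push (w := [Z, _]) ⟨_, h, rfl⟩]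

end

end StackAutomaton

/-- States of the stack automaton for `{aⁿ bⁿ | n ∈ ℕ}`, which stores the letters `a` on the stack
and then moves down one stack symbol for each letter `b`. -/
inductive PowState : Type
  | init | push | pop | done

namespace PowState

instance : Finite PowState :=
  Finite.of_surjective ![init, push, pop, done] fun q => by
    cases q
    exacts [⟨0, rfl⟩, ⟨1, rfl⟩, ⟨2, rfl⟩, ⟨3, rfl⟩]

open StackAutomaton Relation

variable {A : Type u} {a b : A}

/-- A nonerasing stack automaton for `{aⁿ bⁿ | n ∈ ℕ}`. -/
def automaton (a b : A) : StackAutomaton A PowState Unit :=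
  ofAppend init () {init, done}
    (fun q c => {m | c = a ∧ (q = init ∧ m = (push, .right, none) ∨
      q = push ∧ m = (push, .right, some ()))})
    (fun q c _ => {m | c = b ∧ q = push ∧ m = (pop, .stay)})
    (fun q c _ => {m | c = b ∧ q = pop ∧ m = (pop, .right, .left)})
    (fun q c => {m | c = b ∧ q = pop ∧ m = (done, .right)})

/-- The inputs that lead from a configuration of `automaton a b` to acceptance; the number of
letters `a` read so far is the height of the stack. -/
def Productive (a b : A) (c : ID A PowState Unit) : Prop :=
  match c.state with
  | init => c.left.length = 1 → c.input ∈ powPowLanguage a b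
  | push => ∃ m, c.input = .replicate m a ++ .replicate (m + c.left.length) b
  | pop => c.input = .replicate (c.left.length + 1) b
  | done => c.input = []

theorem Productive.of_step {c c' : ID A PowState Unit} (h : (automaton a b).Step c c')
    (hc : Productive a b c') : Productive a b c := by
  cases h with
  | push h =>
    obtain ⟨o, ⟨rfl, ⟨rfl, h⟩ | ⟨rfl, h⟩⟩, rfl⟩ := h <;> cases h
    · obtain ⟨m, hm⟩ := hc
      intro hy
      refine ⟨m + 1, ?_⟩
      simp_all [InputMove.apply, List.replicate_succ]
    · obtain ⟨m, hm⟩ := hc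
      refine ⟨m + 1, ?_⟩
      simp_all [InputMove.apply, List.replicate_succ, add_comm, add_left_comm]
  | readTop h =>
    obtain ⟨rfl, rfl, h⟩ := h
    cases h
    exact ⟨0, by simp_all [Productive, InputMove.apply, List.replicate_succ]⟩
  | insideLeft h =>
    obtain ⟨rfl, rfl, h⟩ := h
    cases h
    simp_all [Productive, InputMove.apply, List.replicate_succ]
  | insideStay h | insideRight h => simp [automaton, ofAppend] at h
  | readBottom h =>
    obtain ⟨rfl, rfl, h⟩ := h
    cases h
    simp_all [Productive, InputMove.apply, List.replicate_succ]

theorem reflTransGen_pop (n : ℕ) (x : Unit) (z : List Unit) :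
    ReflTransGen (automaton a b).Step
      ⟨pop, .replicate (n + 1) b, .replicate n (), x :: z⟩
      ⟨done, [], [()], .replicate n () ++ z⟩ := by
  induction n generalizing x z with
  | zero => exact .single (.readBottom (M := automaton a b) ⟨rfl, rfl, rfl⟩)
  | succ n ih =>
    have h := ih () (x :: z)
    rw [List.append_cons, ← List.replicate_succ'] at h
    exact .head (.insideLeft (M := automaton a b) (d := .right) ⟨rfl, rfl, rfl⟩) h

theorem reflTransGen_push (n m : ℕ) :
    ∃ y z, ReflTransGen (automaton a b).Step
      ⟨push, .replicate m a ++ .replicate (m + n + 1) b, .replicate (n + 1) (), []⟩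
      ⟨done, [], y, z⟩ := by
  induction m generalizing n with
  | zero =>
    rw [Nat.zero_add]
    exact ⟨_, _, .head (.readTop ⟨rfl, rfl, rfl⟩) (reflTransGen_pop n () [])⟩
  | succ m ih =>
    obtain ⟨y, z, h⟩ := ih (n + 1)
    refine ⟨y, z, .head (step_ofAppend_append (o := some ()) ⟨rfl, .inr ⟨rfl, rfl⟩⟩) ?_⟩
    rwa [Nat.succ_add_eq_add_succ]

theorem language_automaton (a b : A) : (automaton a b).language = powPowLanguage a b := by
  ext w
  constructor
  · intro hw
    refine of_mem_language (P := Productive a b) ?_ (fun _ _ => Productive.of_step) hw rfl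
    rintro _ (rfl | rfl) y z
    exacts [fun _ => ⟨0, rfl⟩, rfl]
  · rintro ⟨_ | n, rfl⟩
    · exact ⟨init, .inl rfl, [()], [], .refl⟩
    · obtain ⟨y, z, h⟩ := reflTransGen_push (a := a) (b := b) 0 n
      exact ⟨done, .inr rfl, y, z,
        .head (step_ofAppend_append (o := none) ⟨rfl, .inl ⟨rfl, rfl⟩⟩) h⟩

end PowState

theorem isNonerasingStackLanguage_powPowLanguage {A : Type u} (a b : A) :
    IsNonerasingStackLanguage (powPowLanguage a b) :=
  ⟨PowState, Unit, inferInstance, inferInstance, PowState.automaton a b,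
    StackAutomaton.nonerasing_ofAppend, PowState.language_automaton a b⟩

namespace RefSym

variable {A : Type u} {k : ℕ} {i : Fin k} {p z : List (RefSym A k)} {w : List A}

/-- The words that `v.map e`, read after the string `p`, is dereferenced to, for some `v` that `M`
accepts from the state `s`. -/
def outputs {σ Γ : Type} (M : DFA Γ σ) (e : Γ → RefSym A k) (s : σ) (p : List (RefSym A k)) :
    Language A :=
  {w | ∃ v : List Γ, M.evalFrom s v ∈ M.accept ∧ Emits p (v.map e) w}

theorem append_mem_outputs {σ Γ : Type} {M : DFA Γ σ} {e : Γ → RefSym A k} {s : σ} {Z : Γ}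
    {c : List A} (hc : (e Z).output (register p) = some c)
    (hw : w ∈ outputs M e (M.step s Z) (p ++ [e Z])) : c ++ w ∈ outputs M e s p := by
  obtain ⟨v, hv, h⟩ := hw
  exact ⟨Z :: v, hv, .cons hc h⟩

/-- `Captures i z w`: the letters of `z` before the first `]_i` spell `w`. -/
inductive Captures (i : Fin k) : List (RefSym A k) → List A → Prop
  | closing {z : List (RefSym A k)} : Captures i (closing i :: z) []
  | letter {a : A} {z w} : Captures i z w → Captures i (letter a :: z) (a :: w)
  | skip {x : RefSym A k} {z w} :
      x ≠ closing i → x.toLetter? = none → Captures i z w → Captures i (x :: z) w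

theorem captures_iff : Captures i z w ↔
    closing i ∈ z ∧ eraseBrackets (z.takeWhile fun x => !isClosing i x) = w := by
  constructor
  · intro h
    induction h with
    | closing => simp [isClosing, eraseBrackets]
    | letter _ ih => simp [ih.1, ← ih.2, isClosing, eraseBrackets, toLetter?]
    | @skip x z w hx hx' _ ih =>
      have hx : isClosing i x = false := by rwa [← Bool.not_eq_true, isClosing_iff]
      simp [ih.1, ← ih.2, hx, hx', eraseBrackets]
  · rintro ⟨hz, rfl⟩
    induction z with
    | nil => cases hz
    | cons x z ih =>
      by_cases hx : x = closing i
      · subst hx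
        simpa [isClosing, eraseBrackets] using Captures.closing
      have hx' : isClosing i x = false := by rwa [← Bool.not_eq_true, isClosing_iff]
      replace ih := ih ((List.mem_cons.1 hz).resolve_left (Ne.symm hx))
      cases x with
      | letter => simpa [isClosing, eraseBrackets, toLetter?] using Captures.letter ih
      | opening | closing | ref =>
        simpa [hx', eraseBrackets, List.filterMap_cons, toLetter?] using ih.skip hx rfl

theorem value_register_append_opening (hz : opening i ∉ z) :
    (register (p ++ opening i :: z) i).value = some w ↔ Captures i z w := by
  rw [← capturedValue_eq_value_register, capturedValue, if_pos (any_isOpening_iff.2 (by simp)),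
    afterLastOpening_append_opening_append hz, captures_iff]
  split_ifs with h <;> rw [any_isClosing_iff] at h <;> simp [h]

end RefSym

/-- Consuming an input letter: either it is read, or it is guessed to be the last one and only
marked as consumed, since no move is possible once the input is exhausted. The Booleans tell
whether the last letter is marked, before and after. -/
inductive Consumes : Bool → InputMove → Bool → Prop
  | read : Consumes false .right false
  | last : Consumes false .stay true

/-- `w` remains to be consumed if `u` remains to be read and `f` tells whether the last letter of
the input is marked as consumed. -/
def Pending {A : Type u} (f : Bool) (w u : List A) : Prop :=
  if f then w = [] ∧ ∃ a, u = [a] else w = u ∧ u ≠ []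

namespace Pending

variable {A : Type u} {f f' : Bool} {d : InputMove} {a : A} {w u t : List A}

theorem exists_eq_cons (h : Pending f w u) : ∃ a t, u = a :: t := by
  cases f
  · exact List.exists_cons_of_ne_nil h.2
  · exact ⟨_, [], h.2.choose_spec⟩

theorem of_consumes (hc : Consumes f d f') (h : Pending f' w (d.apply a t)) :
    Pending f (a :: w) (a :: t) := by
  cases hc
  · obtain ⟨rfl, -⟩ := h
    exact ⟨rfl, List.cons_ne_nil _ _⟩
  · obtain ⟨rfl, b, hb⟩ := h
    exact ⟨congrArg (a :: ·) (List.cons.inj hb).2.symm, List.cons_ne_nil _ _⟩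

theorem exists_consumes (h : Pending f (a :: w) u) :
    ∃ t d f', u = a :: t ∧ Consumes f d f' ∧ Pending f' w (d.apply a t) := by
  cases f
  · obtain ⟨rfl, -⟩ := h
    rcases eq_or_ne w [] with rfl | hw
    · exact ⟨[], _, _, rfl, .last, rfl, a, rfl⟩
    · exact ⟨w, _, _, rfl, .read, rfl, hw⟩
  · exact absurd h.1 (List.cons_ne_nil _ _)

end Pending

/-- States of the stack automaton that simulates a deterministic automaton on reference words:
pushing the symbols of the word, searching downwards for `[_i`, copying the captured string, and
going back to the top. -/
inductive RefState (σ : Type) (k : ℕ) : Type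
  | init
  | main (s : σ) (f : Bool)
  | seek (i : Fin k) (s : σ) (f : Bool)
  | copy (i : Fin k) (s : σ) (f : Bool)
  | back (s : σ) (f : Bool)
  | done
  deriving Fintype

namespace RefState

open RefSym StackAutomaton Relation

variable {A : Type u} {k : ℕ} {σ Γ : Type}

section Automaton

variable (M : DFA Γ σ) (e : Γ → RefSym A k)

/-- Moves of `automaton` in pushdown mode. -/
inductive AppendMove : RefState σ k → A → RefState σ k × InputMove × Option Γ → Prop
  | start {a} : AppendMove init a (main M.start false, .stay, none)
  | letter {s f d f' a Z} : e Z = .letter a → Consumes f d f' →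
      AppendMove (main s f) a (main (M.step s Z) f', d, some Z)
  | opening {s f a j Z} : e Z = .opening j →
      AppendMove (main s f) a (main (M.step s Z) f, .stay, some Z)
  | closing {s f a j Z} : e Z = .closing j →
      AppendMove (main s f) a (main (M.step s Z) f, .stay, some Z)
  | ref {s f a i Z} : e Z = .ref i →
      AppendMove (main s f) a (seek i (M.step s Z) f, .stay, some Z)
  | accept {s a} : s ∈ M.accept → AppendMove (main s true) a (done, .right, none)
  | back {s f a} : AppendMove (back s f) a (main s f, .stay, none)

/-- Moves of `automaton` inside the stack. -/
inductive InsideMove : RefState σ k → A → Γ → RefState σ k × InputMove × StackMove → Prop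
  | seek {i s f a Z} : e Z ≠ .opening i → InsideMove (seek i s f) a Z (seek i s f, .stay, .left)
  | found {i s f a Z} : e Z = .opening i → InsideMove (seek i s f) a Z (copy i s f, .stay, .right)
  | copy {i s f d f' a Z} : e Z = .letter a → Consumes f d f' →
      InsideMove (copy i s f) a Z (copy i s f', d, .right)
  | skip {i s f a Z} : e Z ≠ .closing i → (e Z).toLetter? = none →
      InsideMove (copy i s f) a Z (copy i s f, .stay, .right)
  | copied {i s f a Z} : e Z = .closing i →
      InsideMove (copy i s f) a Z (back s f, .stay, .right)
  | back {s f a Z} : InsideMove (back s f) a Z (back s f, .stay, .right)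

variable [Fintype σ] [Finite Γ]

/-- The nonerasing stack automaton that writes on its stack, above `Z₀`, a word `v` accepted by `M`,
and reads the word that `v.map e` is dereferenced to. -/
def automaton (Z₀ : Γ) : StackAutomaton A (RefState σ k) Γ :=
  ofAppend init Z₀ {q | q = done ∨ q = init ∧ [] ∈ outputs M e M.start [e Z₀]}
    (fun q a => {m | AppendMove M e q a m})
    (fun q _ Z => {m | ∃ i s f, q = seek i s f ∧ e Z ≠ .opening i ∧ m = (seek i s f, .stay)})
    (fun q a Z => {m | InsideMove e q a Z m})
    (fun q _ => {m | ∃ i s f, q = seek i s f ∧ m = (back s f, .stay)})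

/-- The symbols on the stack with the part `y` up to the pointer, listed from the pointer down, and
the part `z` above the pointer. -/
def stackWord (y z : List Γ) : List (RefSym A k) :=
  (y.reverse ++ z).map e

/-- The configurations of `automaton` from which acceptance is possible. -/
def Productive (Z₀ : Γ) (c : ID A (RefState σ k) Γ) : Prop :=
  match c.state with
  | init => stackWord e c.left c.right = [e Z₀] → c.input ∈ outputs M e M.start [e Z₀]
  | main s f | back s f => ∃ w ∈ outputs M e s (stackWord e c.left c.right), Pending f w c.input
  | seek i s f => .opening i ∉ c.right.map e →
      ∃ t, (register (stackWord e c.left c.right) i).value = some t ∧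
        ∃ w ∈ outputs M e s (stackWord e c.left c.right), Pending f (t ++ w) c.input
  | copy i s f => ∃ t, Captures i ((c.left.take 1 ++ c.right).map e) t ∧
      ∃ w ∈ outputs M e s (stackWord e c.left c.right), Pending f (t ++ w) c.input
  | done => c.input = []

end Automaton

theorem stackWord_append_singleton (e : Γ → RefSym A k) (y : List Γ) (Z : Γ) :
    stackWord e y [] ++ [e Z] = stackWord e (Z :: y) [] := by
  simp [stackWord]

section Productive

variable {M : DFA Γ σ} {e : Γ → RefSym A k} {Z₀ : Γ} {q q' : RefState σ k} {a : A}
  {d : InputMove} {u : List A} {y z : List Γ} {Y Z : Γ}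

theorem productive_of_append {o : Option Γ} (h : AppendMove M e q a (q', d, o))
    (hc : Productive M e Z₀ ⟨q', d.apply a u, o.toList ++ Z :: y, []⟩) :
    Productive M e Z₀ ⟨q, a :: u, Z :: y, []⟩ := by
  have happend {s : σ} {X : Γ} {c w : List A}
      (hc : (e X).output (register (stackWord e (Z :: y) [])) = some c)
      (hw : w ∈ outputs M e (M.step s X) (stackWord e (X :: Z :: y) [])) :
      c ++ w ∈ outputs M e s (stackWord e (Z :: y) []) :=
    append_mem_outputs hc (by rwa [stackWord_append_singleton])
  cases h with
  | start =>
    obtain ⟨w, hw, rfl, -⟩ := hc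
    intro hx
    exact hx ▸ hw
  | letter hX hd =>
    obtain ⟨w, hw, hp⟩ := hc
    exact ⟨_, happend (by rw [hX]; rfl) hw, hp.of_consumes hd⟩
  | opening hX | closing hX =>
    obtain ⟨w, hw, hp⟩ := hc
    exact ⟨_, happend (c := []) (by rw [hX]; rfl) hw, hp⟩
  | ref hX =>
    obtain ⟨t, ht, w, hw, hp⟩ := hc (by simp)
    rw [Option.toList_some, List.singleton_append, ← stackWord_append_singleton, hX,
      register_append_ref] at ht
    exact ⟨_, happend (by rwa [hX]) hw, hp⟩
  | accept hs =>
    cases hc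
    exact ⟨[], ⟨[], hs, .nil⟩, rfl, a, rfl⟩
  | back => exact hc

theorem productive_of_insideRight (h : InsideMove e q a Z (q', d, .right))
    (hc : Productive M e Z₀ ⟨q', d.apply a u, Y :: Z :: y, z⟩) :
    Productive M e Z₀ ⟨q, a :: u, Z :: y, Y :: z⟩ := by
  have hword : stackWord e (Y :: Z :: y) z = stackWord e (Z :: y) (Y :: z) := by simp [stackWord]
  cases h with
  | @found i s f _ _ hZ =>
    obtain ⟨t, ht, hw⟩ := hc
    intro hY
    refine ⟨t, ?_, hword ▸ hw⟩
    have hword : stackWord e (Z :: y) (Y :: z) =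
        y.reverse.map e ++ .opening i :: (Y :: z).map e := by simp [stackWord, hZ]
    rw [hword]
    exact (value_register_append_opening hY).2 ht
  | copy hZ hd =>
    obtain ⟨t, ht, w, hw, hp⟩ := hc
    refine ⟨a :: t, ?_, w, hword ▸ hw, hp.of_consumes hd⟩
    simpa [hZ] using ht.letter
  | skip hZ hZ' =>
    obtain ⟨t, ht, hw⟩ := hc
    exact ⟨t, ht.skip hZ hZ', hword ▸ hw⟩
  | copied hZ =>
    obtain ⟨w, hw, hp⟩ := hc
    refine ⟨[], ?_, w, hword ▸ hw, hp⟩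
    simpa [hZ] using Captures.closing
  | back =>
    obtain ⟨w, hw, hp⟩ := hc
    exact ⟨w, hword ▸ hw, hp⟩

theorem Productive.of_step [Fintype σ] [Finite Γ] (c c' : ID A (RefState σ k) Γ)
    (h : (automaton M e Z₀).Step c c') (hc : Productive M e Z₀ c') : Productive M e Z₀ c := by
  cases h with
  | push h =>
    obtain ⟨o, h, rfl⟩ := h
    refine productive_of_append h ?_
    cases o <;> exact hc
  | readTop h =>
    obtain ⟨i, s, f, rfl, hZ, h⟩ := h
    cases h
    intro _
    simpa [stackWord, InputMove.apply] using hc (by simpa using Ne.symm hZ)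
  | insideLeft h =>
    cases h with
    | seek hZ =>
    intro hY
    simpa [stackWord, InputMove.apply] using hc (by simpa using ⟨Ne.symm hZ, by simpa using hY⟩)
  | insideStay h => nomatch h
  | insideRight h => exact productive_of_insideRight h hc
  | readBottom h =>
    obtain ⟨i, s, f, rfl, h⟩ := h
    cases h
    obtain ⟨w, hw, hp⟩ := hc
    exact fun hz => ⟨[], congrArg Register.value (register_of_opening_notMem hz), w, hw, hp⟩

end Productive

section Computation

variable [Fintype σ] [Finite Γ] {M : DFA Γ σ} {e : Γ → RefSym A k} {Z₀ : Γ}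
  {q q' : RefState σ k} {a : A} {d : InputMove} {i : Fin k} {s : σ} {f : Bool} {u c w : List A}
  {v y z : List Γ} {T X Y Z : Γ}

theorem AppendMove.step {o : Option Γ} (h : AppendMove M e q a (q', d, o)) :
    (automaton M e Z₀).Step ⟨q, a :: u, Z :: y, []⟩ ⟨q', d.apply a u, o.toList ++ Z :: y, []⟩ :=
  step_ofAppend_append h

theorem InsideMove.step_right (h : InsideMove e q a Z (q', d, .right)) :
    (automaton M e Z₀).Step ⟨q, a :: u, Z :: y, Y :: z⟩ ⟨q', d.apply a u, Y :: Z :: y, z⟩ :=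
  .insideRight h

theorem reflTransGen_back (hw : Pending f w u) :
    ReflTransGen (automaton M e Z₀).Step ⟨back s f, u, Z :: y, z⟩
      ⟨main s f, u, (Z :: z).reverse ++ y, []⟩ := by
  obtain ⟨a, u, rfl⟩ := hw.exists_eq_cons
  induction z generalizing y Z with
  | nil => exact .single AppendMove.back.step
  | cons Y z ih =>
    simpa using ReflTransGen.head InsideMove.back.step_right (ih (Z := Y) (y := Z :: y))

theorem exists_reflTransGen_copy (hc : Captures i ((Z :: z).map e) c) (hw : Pending f (c ++ w) u) :
    ∃ f' u', Pending f' w u' ∧ ReflTransGen (automaton M e Z₀).Step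
      ⟨copy i s f, u, Z :: y, z ++ [T]⟩ ⟨main s f', u', (Z :: z ++ [T]).reverse ++ y, []⟩ := by
  generalize hx : (Z :: z).map e = x at hc
  induction hc generalizing Z z y f u with
  | closing =>
    obtain ⟨hZ, -⟩ := List.cons.inj hx
    obtain ⟨a, u, rfl⟩ := hw.exists_eq_cons
    obtain ⟨Y, t, ht⟩ := List.exists_cons_of_ne_nil (List.append_ne_nil_of_right_ne_nil z
      (List.cons_ne_nil T []))
    refine ⟨f, a :: u, hw, ?_⟩
    rw [List.cons_append, ht]
    simpa [InputMove.apply] using ReflTransGen.head (InsideMove.copied hZ).step_right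
      (reflTransGen_back (y := Z :: y) (Z := Y) hw)
  | letter hc ih =>
    obtain ⟨hZ, rfl⟩ := List.cons.inj hx
    obtain ⟨u, d, f', rfl, hd, hw⟩ := hw.exists_consumes
    rcases z with _ | ⟨Y, z⟩
    · cases hc
    · obtain ⟨f', u', hw', h⟩ := ih (y := Z :: y) hw rfl
      refine ⟨f', u', hw', ?_⟩
      simpa using ReflTransGen.head (InsideMove.copy hZ hd).step_right h
  | skip hx₁ hx₂ hc ih =>
    obtain ⟨rfl, rfl⟩ := List.cons.inj hx
    obtain ⟨a, u, rfl⟩ := hw.exists_eq_cons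
    rcases z with _ | ⟨Y, z⟩
    · cases hc
    · obtain ⟨f', u', hw', h⟩ := ih (y := Z :: y) hw rfl
      refine ⟨f', u', hw', ?_⟩
      simpa using ReflTransGen.head (InsideMove.skip hx₁ hx₂).step_right h

theorem exists_reflTransGen_seek (hz : .opening i ∉ z.map e)
    (hc : (register (stackWord e y z) i).value = some c) (hw : Pending f (c ++ w) u) :
    ∃ f' u', Pending f' w u' ∧ ReflTransGen (automaton M e Z₀).Step
      ⟨seek i s f, u, y, z ++ [T]⟩ ⟨main s f', u', (z ++ [T]).reverse ++ y, []⟩ := by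
  obtain ⟨a, u, rfl⟩ := hw.exists_eq_cons
  obtain ⟨Y, t, ht⟩ := List.exists_cons_of_ne_nil (List.append_ne_nil_of_right_ne_nil z
    (List.cons_ne_nil T []))
  induction y generalizing z Y t with
  | nil =>
    have hc' : register (stackWord e [] z) i = .unset := register_of_opening_notMem hz
    rw [hc'] at hc
    cases hc
    rw [ht]
    exact ⟨f, a :: u, hw, .head (.readBottom (M := automaton M e Z₀) (d := .stay)
      ⟨i, s, f, rfl, rfl⟩) (reflTransGen_back hw)⟩
  | cons Z y ih =>
    by_cases hZ : e Z = .opening i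
    · have hword : stackWord e (Z :: y) z = y.reverse.map e ++ .opening i :: z.map e := by
        simp [stackWord, hZ]
      rw [hword, value_register_append_opening hz] at hc
      rcases z with _ | ⟨Y, z⟩
      · cases hc
      · obtain ⟨f', u', hw', h⟩ := exists_reflTransGen_copy (M := M) (Z₀ := Z₀) (s := s) (T := T)
          (y := Z :: y) hc hw
        exact ⟨f', u', hw', .head (InsideMove.found hZ).step_right h⟩
    · obtain ⟨f', u', hw', h⟩ := ih (z := Z :: z) (by simpa using ⟨Ne.symm hZ, by simpa using hz⟩)
        (by simpa [stackWord] using hc) _ _ rfl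
      refine ⟨f', u', hw', ?_⟩
      rw [List.cons_append, ht] at h
      rw [ht]
      simpa using ReflTransGen.head (.insideLeft (M := automaton M e Z₀) (d := .stay) (.seek hZ)) h

theorem exists_reflTransGen_ref (hX : e X = .ref i)
    (hc : (register (stackWord e (Z :: y) []) i).value = some c) (hw : Pending f (c ++ w) u) :
    ∃ f' u', Pending f' w u' ∧ ReflTransGen (automaton M e Z₀).Step ⟨main s f, u, Z :: y, []⟩
      ⟨main (M.step s X) f', u', X :: Z :: y, []⟩ := by
  obtain ⟨f', u', hw', h⟩ := exists_reflTransGen_seek (M := M) (Z₀ := Z₀) (z := [])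
    (s := M.step s X) (T := X) (by simp) hc hw
  obtain ⟨a, u, rfl⟩ := hw.exists_eq_cons
  refine ⟨f', u', hw', .head (AppendMove.ref hX).step (.head ?_ h)⟩
  exact .readTop (M := automaton M e Z₀) (d := .stay) ⟨i, _, f, rfl, by simp [hX], rfl⟩

theorem exists_reflTransGen_main (hv : Emits (stackWord e (Z :: y) []) (v.map e) w)
    (hs : M.evalFrom s v ∈ M.accept) (hw : Pending f w u) :
    ∃ y' z, ReflTransGen (automaton M e Z₀).Step ⟨main s f, u, Z :: y, []⟩ ⟨done, [], y', z⟩ := by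
  induction v generalizing s f u w y Z with
  | nil =>
    cases hv
    cases f
    · exact absurd hw.1.symm hw.2
    · obtain ⟨-, a, rfl⟩ := hw
      exact ⟨_, _, .single (AppendMove.accept hs).step⟩
  | cons X v ih =>
    obtain _ | ⟨hc, hv⟩ := hv
    rw [stackWord_append_singleton] at hv
    suffices ∃ f' u', Pending f' _ u' ∧ ReflTransGen (automaton M e Z₀).Step
        ⟨main s f, u, Z :: y, []⟩ ⟨main (M.step s X) f', u', X :: Z :: y, []⟩ by
      obtain ⟨f', u', hw', h⟩ := this
      obtain ⟨y', z, h'⟩ := ih hv hs hw'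
      exact ⟨y', z, h.trans h'⟩
    rcases hX : e X with a | j | j | i <;> rw [hX] at hc
    · cases hc
      obtain ⟨u, d, f', rfl, hd, hw⟩ := hw.exists_consumes
      exact ⟨f', _, hw, .single (AppendMove.letter hX hd).step⟩
    · cases hc
      obtain ⟨a, u, rfl⟩ := hw.exists_eq_cons
      exact ⟨f, _, hw, .single (AppendMove.opening hX).step⟩
    · cases hc
      obtain ⟨a, u, rfl⟩ := hw.exists_eq_cons
      exact ⟨f, _, hw, .single (AppendMove.closing hX).step⟩
    · exact exists_reflTransGen_ref hX hc hw

theorem language_automaton : (automaton M e Z₀).language = outputs M e M.start [e Z₀] := by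
  ext w
  constructor
  · intro hw
    refine of_mem_language (P := Productive M e Z₀) ?_ Productive.of_step hw ?_
    · rintro _ (rfl | ⟨rfl, h⟩) y z
      exacts [rfl, fun _ => h]
    · simp [stackWord, automaton, ofAppend]
  · intro hw
    rcases w with _ | ⟨a, w⟩
    · exact ⟨init, .inr ⟨rfl, hw⟩, _, _, .refl⟩
    · obtain ⟨v, hv, h⟩ := hw
      obtain ⟨y, z, h⟩ := exists_reflTransGen_main (e := e) (Z₀ := Z₀) (Z := Z₀) (y := [])
        (by simpa [stackWord] using h) hv (f := false) ⟨rfl, List.cons_ne_nil a w⟩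
      exact ⟨done, .inl rfl, y, z, .head AppendMove.start.step h⟩

end Computation

end RefState

namespace RefSym

variable {A : Type u} {k : ℕ}

theorem isNonerasingStackLanguage_deref (i : Fin k) {R : Language (RefSym A k)}
    (hR : R.IsRegular) (hR' : ∀ v ∈ R, NoOpenReference v) {S : Set (RefSym A k)} (hS : S.Finite)
    (hRS : ∀ v ∈ R, ∀ x ∈ v, x ∈ S) :
    IsNonerasingStackLanguage {w | ∃ v ∈ R, deref v = some w} := by
  obtain ⟨σ, _, M, rfl⟩ := hR
  obtain ⟨n, e, -, he⟩ := (hS.insert (ref i)).fin_param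
  obtain ⟨Z₀, hZ₀⟩ : ref i ∈ Set.range e := he ▸ Set.mem_insert (ref i) S
  refine ⟨RefState σ k, Fin n, inferInstance, inferInstance, RefState.automaton (M.comap e) e Z₀,
    StackAutomaton.nonerasing_ofAppend, ?_⟩
  rw [RefState.language_automaton, hZ₀]
  have haccepts (v : List (Fin n)) :
      (M.comap e).evalFrom (M.comap e).start v ∈ (M.comap e).accept ↔ v.map e ∈ M.accepts :=
    Set.ext_iff.1 (DFA.accepts_comap M e) v
  ext w
  constructor
  · rintro ⟨v, hv, h⟩
    rw [haccepts] at hv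
    exact ⟨v.map e, hv, (hR' _ hv).emits_iff.1 h⟩
  · rintro ⟨v, hv, h⟩
    obtain ⟨v, rfl⟩ : v ∈ Set.range (List.map e) := by
      rw [Set.range_list_map, he]
      exact fun x hx => .inr (hRS v hv x hx)
    exact ⟨v, (haccepts v).2 hv, (hR' _ hv).emits_iff.2 h⟩

theorem derefFrom_map_letter (p : List (RefSym A k)) (w : List A) :
    derefFrom p (w.map letter) = some (eraseBrackets p ++ w) := by
  induction w generalizing p with
  | nil => simp [derefFrom]
  | cons a w ih => simp [derefFrom, ih, eraseBrackets, toLetter?]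

end RefSym

namespace Rewb

open RefSym

variable {A : Type u}

theorem exists_regularExpression (α : Rewb A) :
    ∃ (k : ℕ) (_ : 1 ≤ k) (r : RegularExpression (RefSym A k)),
      α.language = {w | ∃ v ∈ r.matches', deref v = some w} ∧
      (α.NoCapturedReference → ∀ v ∈ r.matches', NoOpenReference v) := by
  cases α with
  | backref k hk α hα =>
    refine ⟨k, hk, α.toRegularExpression, ?_⟩
    rw [α.matches'_toRegularExpression]
    exact ⟨rfl, fun h => h.noOpenReference⟩
  | regular r =>
    refine ⟨1, le_rfl, r.map letter, ?_, ?_⟩ <;> rw [RegularExpression.matches'_map]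
    · have hderef (w : List A) : deref (w.map (letter (k := 1))) = some w :=
        derefFrom_map_letter [] w
      ext w
      constructor
      · exact fun hw => ⟨_, ⟨w, hw, rfl⟩, hderef w⟩
      · rintro ⟨_, ⟨v, hv, rfl⟩, hvw⟩
        rw [hderef] at hvw
        exact Option.some.inj hvw ▸ hv
    · rintro - _ ⟨v, -, rfl⟩
      exact noOpenReference_of_ref_notMem (by simp)

theorem NoCapturedReference.isNonerasingStackLanguage {α : Rewb A}
    (hα : α.NoCapturedReference) : IsNonerasingStackLanguage α.language := by
  obtain ⟨k, hk, r, hL, hr⟩ := α.exists_regularExpression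
  obtain ⟨S, hS, hrS⟩ := RegularLanguage.exists_finite_forall_mem_matches' r
  exact hL ▸ isNonerasingStackLanguage_deref ⟨0, hk⟩ (RegularLanguage.matches'_isRegular r) (hr hα)
    hS hrS

theorem language_ne_powPowLanguage (α : Rewb A) {a b : A} (hab : a ≠ b) :
    α.language ≠ powPowLanguage a b := by
  obtain ⟨k, -, r, hL, -⟩ := α.exists_regularExpression
  intro h
  have hmem {w : List A} : w ∈ powPowLanguage a b ↔ ∃ v ∈ r.matches', deref v = some w := by
    rw [← h, hL]
    rfl
  obtain ⟨m, n, hmn, hv⟩ := exists_deref_eq_append_of_infinite (a := a)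
    (RegularLanguage.matches'_isRegular r) (u := fun n => .replicate n a)
    (w := fun n => .replicate n b)
    (fun n _ => List.eq_of_mem_replicate) (fun n hn => hab (List.eq_of_mem_replicate hn))
    fun n => hmem.1 ⟨n, rfl⟩
  obtain ⟨l, hl⟩ := hmem.2 hv
  classical
  have ha := congrArg (List.count a) hl
  have hb := congrArg (List.count b) hl
  simp only [List.count_append, List.count_replicate_self, List.count_replicate, beq_iff_eq,
    hab, hab.symm, if_false, add_zero, zero_add] at ha hb
  exact hmn (ha.trans hb.symm)

end Rewb

theorem mainTheorem4_general :
    (∀ (A : Type u) (α : Rewb A), α.NoCapturedReference →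
      IsNonerasingStackLanguage α.language) ∧
    (∀ (A : Type u) [Nontrivial A], ¬ ∀ L : Language A, IsNonerasingStackLanguage L →
      ∃ α : Rewb A, α.NoCapturedReference ∧ α.language = L) ∧
    (∀ (A : Type u) (a b : A), a ≠ b →
      IsNonerasingStackLanguage (powPowLanguage a b) ∧
      ∀ α : Rewb A, α.language ≠ powPowLanguage a b) := by
  refine ⟨fun A α hα => hα.isNonerasingStackLanguage, fun A _ h => ?_, fun A a b hab =>
    ⟨isNonerasingStackLanguage_powPowLanguage a b, fun α => α.language_ne_powPowLanguage hab⟩⟩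
  obtain ⟨a, b, hab⟩ := exists_pair_ne A
  obtain ⟨α, -, hα⟩ := h _ (isNonerasingStackLanguage_powPowLanguage a b)
  exact α.language_ne_powPowLanguage hab hα

theorem mainTheorem4 :
    -- over every finite alphabet, rewbs without a captured reference describe
    -- nonerasing stack languages
    (∀ (A : Type u) [Finite A] (α : Rewb A), α.NoCapturedReference →
      IsNonerasingStackLanguage α.language) ∧
    -- but not vice versa
    (¬ ∀ (A : Type u) [Finite A] (L : Language A), IsNonerasingStackLanguage L →
      ∃ α : Rewb A, α.NoCapturedReference ∧ α.language = L) ∧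
    -- as witnessed by `{aⁿ bⁿ | n ∈ ℕ}`, which no rewb at all describes
    (∀ (A : Type u) [Finite A] (a b : A), a ≠ b →
      IsNonerasingStackLanguage (powPowLanguage a b) ∧
      ∀ α : Rewb A, α.language ≠ powPowLanguage a b) := by
  obtain ⟨hL, hconverse, hpow⟩ := mainTheorem4_general.{u}
  exact ⟨fun A _ => hL A, fun h => hconverse (ULift Bool) (h _), fun A _ => hpow A⟩
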